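/- All Hilbert spaces are complex, and an operator space is a linear subspace $E\subset B(\mathcal H,\mathcal K)$ of bounded operators between two Hilbert spaces, with the matrix norms that $M_n(E)$ inherits from $M_n(B(\mathcal H,\mathcal K))=B(\mathcal H^n,\mathcal K^n)$. For a linear map $u\colon E\to F$ between operator spaces, $\|u\|_{cb}=\sup_n\|\mathrm{id}\otimes u\colon M_n(E)\to M_n(F)\|$, and $u$ is completely bounded if $\|u\|_{cb}<\infty$. A complete isomorphism is a linear bijection $u$ such that $u$ and $u^{-1}$ are completely bounded; $E\simeq F$ means that one exists, and $d_{cb}(E,F)=\inf\|u\|_{cb}\|u^{-1}\|_{cb}$ over all complete isomorphisms $u\colon E\to F$. The direct sum $E\oplus F$ of operator spaces consists of the block diagonal operators $a\oplus b$ with $a\in E$, $b\in F$. Let $R=\overline{\mathrm{span}}\{e_{1j}\mid j\ge 1\}$ and $C=\overline{\mathrm{span}}\{e_{i1}\mid i\ge 1\}$ in $B(\ell_2)$, and for Hilbert spaces $H,K$ let $H_r=B(H^*,\mathbb C)$ and $K_c=B(\mathbb C,K)$. **Theorem.** There is a numerical constant $c$ with the following property. Let $S\subset R\oplus C$ be a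 closed subspace and let $P\colon R\oplus C\to S$ be a completely bounded linear projection onto $S$. Then there are Hilbert spaces $H,K$ such that $S\simeq H_r\oplus K_c$ and $$d_{cb}(S,H_r\oplus K_c)\le c\,\|P\|_{cb}.$$ -/

import Mathlib

open scoped ENNReal NNReal InnerProductSpace

noncomputable section

namespace OpSp

/-! Concrete operator spaces: linear subspaces `E` of `B(H, K)`, with `H` and `K` complex Hilbert
spaces, together with the matrix norms that they inherit from `M_n(B(H, K)) = B(H^n, K^n)`. -/

section General

variable {H K H₁ K₁ H₂ K₂ : Type*}
  [NormedAddCommGroup H] [InnerProductSpace ℂ H] [NormedAddCommGroup K] [InnerProductSpace ℂ K]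
  [NormedAddCommGroup H₁] [InnerProductSpace ℂ H₁] [NormedAddCommGroup K₁] [InnerProductSpace ℂ K₁]
  [NormedAddCommGroup H₂] [InnerProductSpace ℂ H₂] [NormedAddCommGroup K₂] [InnerProductSpace ℂ K₂]

/-- A matrix `(x i j)` of operators `H → K`, viewed as the operator
`(h j) ↦ (∑ j, x i j (h j))` from the Hilbertian direct sum `H^n` to `K^n`. -/
def matrixOp {n : ℕ} (x : Matrix (Fin n) (Fin n) (H →L[ℂ] K)) :
    PiLp 2 (fun _ : Fin n => H) →L[ℂ] PiLp 2 (fun _ : Fin n => K) :=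
  ((PiLp.continuousLinearEquiv 2 ℂ (fun _ : Fin n => K)).symm :
      (Fin n → K) →L[ℂ] PiLp 2 (fun _ : Fin n => K)).comp
    ((ContinuousLinearMap.pi fun i => ∑ j, (x i j).comp (ContinuousLinearMap.proj j)).comp
      (PiLp.continuousLinearEquiv 2 ℂ (fun _ : Fin n => H) :
        PiLp 2 (fun _ : Fin n => H) →L[ℂ] (Fin n → H)))

/-- The norm of `M_n(E)` for an operator space `E ⊆ B(H, K)`. -/
def matrixNorm (E : Submodule ℂ (H →L[ℂ] K)) {n : ℕ} (x : Matrix (Fin n) (Fin n) E) : ℝ≥0∞ :=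
  ‖matrixOp (x.map fun a : E => (a : H →L[ℂ] K))‖ₑ

/-- The completely bounded norm `‖u‖_cb = sup_n ‖u_n : M_n(E) → M_n(F)‖`, in `[0, ∞]`, where `u_n`
applies `u` to each entry. -/
def cbNorm {E : Submodule ℂ (H₁ →L[ℂ] K₁)} {F : Submodule ℂ (H₂ →L[ℂ] K₂)} (u : E →ₗ[ℂ] F) :
    ℝ≥0∞ :=
  ⨆ (n : ℕ) (x : Matrix (Fin n) (Fin n) E) (_ : matrixNorm E x ≤ 1), matrixNorm F (x.map u)

/-- `u` is completely bounded. -/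
def IsCB {E : Submodule ℂ (H₁ →L[ℂ] K₁)} {F : Submodule ℂ (H₂ →L[ℂ] K₂)} (u : E →ₗ[ℂ] F) :
    Prop :=
  cbNorm u < ∞

/-- `E ≃ F`: the operator spaces `E` and `F` are completely isomorphic. -/
def CompletelyIsomorphic (E : Submodule ℂ (H₁ →L[ℂ] K₁)) (F : Submodule ℂ (H₂ →L[ℂ] K₂)) : Prop :=
  ∃ u : E ≃ₗ[ℂ] F, IsCB (u : E →ₗ[ℂ] F) ∧ IsCB (u.symm : F →ₗ[ℂ] E)

/-- The completely bounded distance `d_cb(E, F) = inf ‖u‖_cb ‖u⁻¹‖_cb`, the infimum over all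
complete isomorphisms `u : E → F` (it is `∞` if there are none). -/
def cbDist (E : Submodule ℂ (H₁ →L[ℂ] K₁)) (F : Submodule ℂ (H₂ →L[ℂ] K₂)) : ℝ≥0∞ :=
  ⨅ (u : E ≃ₗ[ℂ] F) (_ : IsCB (u : E →ₗ[ℂ] F)) (_ : IsCB (u.symm : F →ₗ[ℂ] E)),
    cbNorm (u : E →ₗ[ℂ] F) * cbNorm (u.symm : F →ₗ[ℂ] E)

/-- The block diagonal operator `A ⊕ B : H₁ ⊕ H₂ → K₁ ⊕ K₂` between Hilbertian direct sums, as a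
linear function of the pair `(A, B)`. -/
def blockDiag : ((H₁ →L[ℂ] K₁) × (H₂ →L[ℂ] K₂)) →ₗ[ℂ]
    (WithLp 2 (H₁ × H₂) →L[ℂ] WithLp 2 (K₁ × K₂)) where
  toFun T :=
    ((WithLp.prodContinuousLinearEquiv 2 ℂ K₁ K₂).symm :
        (K₁ × K₂) →L[ℂ] WithLp 2 (K₁ × K₂)).comp
      ((T.1.prodMap T.2).comp
        (WithLp.prodContinuousLinearEquiv 2 ℂ H₁ H₂ : WithLp 2 (H₁ × H₂) →L[ℂ] (H₁ × H₂)))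
  map_add' _ _ := rfl
  map_smul' _ _ := rfl

/-- The direct sum `E ⊕ F` of operator spaces, realized by block diagonal operators (so that the
norm of `M_n(E ⊕ F)` is the maximum of the norms of the two components). -/
def directSum (E : Submodule ℂ (H₁ →L[ℂ] K₁)) (F : Submodule ℂ (H₂ →L[ℂ] K₂)) :
    Submodule ℂ (WithLp 2 (H₁ × H₂) →L[ℂ] WithLp 2 (K₁ × K₂)) :=
  (E.prod F).map blockDiag

end General

/-! The row and column spaces. -/

/-- The Hilbert space `ℓ₂`. -/
abbrev EllTwo : Type := lp (fun _ : ℕ => ℂ) 2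

/-- The canonical basis vectors of `ℓ₂`. -/
def basisVec (i : ℕ) : EllTwo := lp.single 2 i (1 : ℂ)

/-- The matrix unit `e_{ij}` in `B(ℓ₂)`, that is, `z ↦ ⟪e_j, z⟫ e_i`. -/
def matrixUnit (i j : ℕ) : EllTwo →L[ℂ] EllTwo :=
  InnerProductSpace.rankOne ℂ (basisVec i) (basisVec j)

/-- The row space `R`, the closed span in `B(ℓ₂)` of the matrix units of the first row. -/
def R : Submodule ℂ (EllTwo →L[ℂ] EllTwo) :=
  (Submodule.span ℂ (Set.range fun j : ℕ => matrixUnit 0 j)).topologicalClosure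

/-- The column space `C`, the closed span in `B(ℓ₂)` of the matrix units of the first column. -/
def C : Submodule ℂ (EllTwo →L[ℂ] EllTwo) :=
  (Submodule.span ℂ (Set.range fun i : ℕ => matrixUnit i 0)).topologicalClosure

section Hilbert

variable (H : Type*) [NormedAddCommGroup H] [InnerProductSpace ℂ H] [CompleteSpace H]

/-- The dual `H^*` of a Hilbert space `H`, with its usual norm, is a Hilbert space: the Riesz
isomorphism is conjugate linear, so the inner product is transported with its arguments swapped. -/
instance dualInnerProductSpace : InnerProductSpace ℂ (StrongDual ℂ H) where
  inner f g := ⟪(InnerProductSpace.toDual ℂ H).symm g, (InnerProductSpace.toDual ℂ H).symm f⟫_ℂ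
  norm_sq_eq_re_inner f := by
    rw [← (InnerProductSpace.toDual ℂ H).symm.norm_map f]
    exact norm_sq_eq_re_inner _
  conj_inner_symm f g := inner_conj_symm _ _
  add_left f g h := by rw [map_add, inner_add_right]
  smul_left f g r := by rw [map_smulₛₗ, inner_smul_right]

/-- The row Hilbert space `H_r = B(H^*, ℂ)`. -/
def rowSpace : Submodule ℂ (StrongDual ℂ H →L[ℂ] ℂ) := ⊤

/-- The column Hilbert space `H_c = B(ℂ, H)`. -/
def colSpace : Submodule ℂ (ℂ →L[ℂ] H) := ⊤

end Hilbert

end OpSp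

end

noncomputable section

namespace OpSp

/-! An element of `R ⊕ C` is a functional (its row part) together with a vector (its column part),
and a matrix over `R ⊕ C` has norm the maximum of the row norm of its row parts and the column norm
of its column parts. Since `S` is closed, it is complete in the Hilbert norm ‖s‖² = ‖row part‖² +
‖column part‖². Call this Hilbert space V and let α, β be the two coordinate maps, so that α†α + β†β
= 1. Split V by the sign of α†α - β†β: take N to be the kernel of its positive part. Then α
dominates β on Nᗮ, β dominates α on N, and both α and β keep Nᗮ and N orthogonal
(`exists_splitting`). Hence v ↦ (component in Nᗮ, component in N) is completely bounded from S to
(Nᗮ)_r ⊕ N_c, for any closed S. The inverse needs P. Its matrix norms are controlled once β on Nᗮ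
and α on N are Hilbert–Schmidt, since a Hilbert–Schmidt map is completely bounded between row and
column spaces (`colBound_of_rowBound`). Conversely, a completely bounded map from row to column
space, or back, is Hilbert–Schmidt. Write the identity of V as p + q, where p and q apply P to the
row and the column summand. Then βp is Hilbert–Schmidt relative to α, and αq relative to β, both
with bound M = ‖P‖_cb. On Nᗮ one projects p + q back to Nᗮ; there β is controlled by βp on the first
term and by α, hence αq, on the second (`sum_sq_le_of_decomposition`). The case of N is symmetric.
-/

/-- `∑ i, ‖∑ j, ξ j • x i j‖² ≤ c² ∑ j, ‖ξ j‖²` for all `ξ`: the norm of the matrix `x` of vectors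
in the column Hilbert space is at most `c`. -/
def ColBound {V : Type*} [SeminormedAddCommGroup V] [NormedSpace ℂ V] {n : ℕ}
    (x : Fin n → Fin n → V) (c : ℝ) : Prop :=
  ∀ ξ : Fin n → ℂ, ∑ i, ‖∑ j, ξ j • x i j‖ ^ 2 ≤ c ^ 2 * ∑ j, ‖ξ j‖ ^ 2

/-- The norm of the matrix `x` of vectors in the row Hilbert space is at most `c`. -/
def RowBound {V : Type*} [SeminormedAddCommGroup V] [NormedSpace ℂ V] {n : ℕ}
    (x : Fin n → Fin n → V) (c : ℝ) : Prop :=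
  ColBound (fun i j => x j i) c

/-- The norm of the operator matrix `x` is at most `c`. -/
def MatBound {H K : Type*} [NormedAddCommGroup H] [InnerProductSpace ℂ H] [NormedAddCommGroup K]
    [InnerProductSpace ℂ K] {n : ℕ} (x : Fin n → Fin n → H →L[ℂ] K) (c : ℝ) : Prop :=
  ∀ h : Fin n → H, ∑ i, ‖∑ j, x i j (h j)‖ ^ 2 ≤ c ^ 2 * ∑ j, ‖h j‖ ^ 2

/-! ### Matrices of vectors in row and column Hilbert spaces -/

section Bounds

variable {V W : Type*} [SeminormedAddCommGroup V] [NormedSpace ℂ V]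
  [SeminormedAddCommGroup W] [NormedSpace ℂ W] {n : ℕ}

theorem colBound_of_unit {x : Fin n → Fin n → V} {c : ℝ}
    (h : ∀ ξ : Fin n → ℂ, ∑ j, ‖ξ j‖ ^ 2 = 1 → ∑ i, ‖∑ j, ξ j • x i j‖ ^ 2 ≤ c ^ 2) :
    ColBound x c := by
  intro ξ
  have hnn : 0 ≤ ∑ j, ‖ξ j‖ ^ 2 := Finset.sum_nonneg fun _ _ => sq_nonneg _
  rcases hnn.eq_or_lt with h0 | h0
  · have hz : ∀ j, ξ j = 0 := fun j => by
      have := (Finset.sum_eq_zero_iff_of_nonneg (fun _ _ => sq_nonneg _)).1 h0.symm j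
        (Finset.mem_univ j)
      simpa using this
    simp [hz]
  · set t : ℝ := Real.sqrt (∑ j, ‖ξ j‖ ^ 2) with ht
    have htpos : 0 < t := Real.sqrt_pos.2 h0
    have ht2 : t ^ 2 = ∑ j, ‖ξ j‖ ^ 2 := Real.sq_sqrt hnn
    have key := h (fun j => (t : ℂ)⁻¹ * ξ j) (by
      simp only [norm_mul, mul_pow, ← Finset.mul_sum, ← ht2]
      simp [htpos.ne'])
    simp only [mul_smul, ← Finset.smul_sum, norm_smul, mul_pow, ← Finset.mul_sum] at key
    simp only [norm_inv, Complex.norm_real, Real.norm_eq_abs, abs_of_pos htpos, inv_pow] at key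
    rw [← ht2]
    rwa [inv_mul_le_iff₀ (by positivity), mul_comm] at key

theorem ColBound.add {x y : Fin n → Fin n → V} {c d : ℝ} (hx : ColBound x c) (hy : ColBound y d)
    (hc : 0 ≤ c) (hd : 0 ≤ d) : ColBound (fun i j => x i j + y i j) (c + d) := by
  refine colBound_of_unit fun ξ hξ => ?_
  have h1 := hx ξ
  have h2 := hy ξ
  rw [hξ, mul_one] at h1 h2
  set a : Fin n → ℝ := fun i => ‖∑ j, ξ j • x i j‖
  set b : Fin n → ℝ := fun i => ‖∑ j, ξ j • y i j‖
  have hab : ∑ i, a i * b i ≤ c * d := by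
    refine abs_le_of_sq_le_sq' ?_ (by positivity) |>.2
    calc (∑ i, a i * b i) ^ 2 ≤ (∑ i, a i ^ 2) * ∑ i, b i ^ 2 :=
          Finset.sum_mul_sq_le_sq_mul_sq _ _ _
      _ ≤ c ^ 2 * d ^ 2 := by gcongr
      _ = (c * d) ^ 2 := by ring
  calc ∑ i, ‖∑ j, ξ j • (x i j + y i j)‖ ^ 2 ≤ ∑ i, (a i + b i) ^ 2 := by
        refine Finset.sum_le_sum fun i _ => ?_
        simp only [smul_add, Finset.sum_add_distrib]
        gcongr
        exact norm_add_le _ _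
    _ = ∑ i, a i ^ 2 + 2 * ∑ i, a i * b i + ∑ i, b i ^ 2 := by
        rw [Finset.mul_sum, ← Finset.sum_add_distrib, ← Finset.sum_add_distrib]
        exact Finset.sum_congr rfl fun i _ => by ring
    _ ≤ (c + d) ^ 2 := by nlinarith

/-- A linear map that is dominated pointwise by another one satisfies its column bounds. -/
theorem ColBound.of_norm_le {U : Type*} [AddCommGroup U] [Module ℂ U] (f : U →ₗ[ℂ] V)
    (g : U →ₗ[ℂ] W) {k c : ℝ} (hfg : ∀ u, ‖f u‖ ^ 2 ≤ k ^ 2 * ‖g u‖ ^ 2)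
    {x : Fin n → Fin n → U} (h : ColBound (fun i j => g (x i j)) c) :
    ColBound (fun i j => f (x i j)) (k * c) := by
  intro ξ
  have h' := h ξ
  simp only [← map_smul, ← map_sum] at h' ⊢
  calc _ ≤ ∑ i, k ^ 2 * ‖g (∑ j, ξ j • x i j)‖ ^ 2 := Finset.sum_le_sum fun i _ => hfg _
    _ ≤ k ^ 2 * (c ^ 2 * ∑ j, ‖ξ j‖ ^ 2) := by rw [← Finset.mul_sum]; gcongr
    _ = _ := by ring

/-- A linear map `f` that is bounded (by `k`) on the families `v` with `‖∑ η i • v i‖ ≤ ‖η‖` maps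
row bounded matrices to column bounded ones. -/
theorem colBound_of_rowBound (f : V →ₗ[ℂ] W) {k : ℝ}
    (hf : ∀ v : Fin n → V, (∀ η : Fin n → ℂ, ‖∑ i, η i • v i‖ ^ 2 ≤ ∑ i, ‖η i‖ ^ 2) →
      ∑ i, ‖f (v i)‖ ^ 2 ≤ k ^ 2)
    {x : Fin n → Fin n → V} (h : RowBound x 1) : ColBound (fun i j => f (x i j)) k := by
  refine colBound_of_unit fun ξ hξ => ?_
  simp only [← map_smul, ← map_sum]
  refine hf _ fun η => ?_
  have h' := h η
  simp only [one_pow, one_mul] at h'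
  have hsw : ∑ i, η i • ∑ j, ξ j • x i j = ∑ j, ξ j • ∑ i, η i • x i j := by
    simp only [Finset.smul_sum]
    rw [Finset.sum_comm]
    exact Finset.sum_congr rfl fun _ _ => Finset.sum_congr rfl fun _ _ => smul_comm _ _ _
  -- Cauchy–Schwarz in j: contracting the columns of x with a unit vector ξ leaves a family bounded
  -- as `hf` requires.
  rw [hsw]
  calc _ ≤ (∑ j, ‖ξ j‖ * ‖∑ i, η i • x i j‖) ^ 2 := by
        gcongr
        exact (norm_sum_le _ _).trans_eq (by simp only [norm_smul])
    _ ≤ (∑ j, ‖ξ j‖ ^ 2) * ∑ j, ‖∑ i, η i • x i j‖ ^ 2 :=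
        Finset.sum_mul_sq_le_sq_mul_sq _ _ _
    _ ≤ _ := by rw [hξ, one_mul]; exact h'

end Bounds

/-! ### Matrix norms and cb norms as real inequalities -/

section Norms

variable {H K H₁ K₁ H₂ K₂ : Type*}
  [NormedAddCommGroup H] [InnerProductSpace ℂ H] [NormedAddCommGroup K] [InnerProductSpace ℂ K]
  [NormedAddCommGroup H₁] [InnerProductSpace ℂ H₁] [NormedAddCommGroup K₁] [InnerProductSpace ℂ K₁]
  [NormedAddCommGroup H₂] [InnerProductSpace ℂ H₂] [NormedAddCommGroup K₂] [InnerProductSpace ℂ K₂]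
  {n : ℕ}

theorem matrixNorm_le_iff {E : Submodule ℂ (H →L[ℂ] K)} {x : Matrix (Fin n) (Fin n) E} {c : ℝ}
    (hc : 0 ≤ c) :
    matrixNorm E x ≤ ENNReal.ofReal c ↔ MatBound (fun i j => (x i j : H →L[ℂ] K)) c := by
  have hval : ∀ (h : PiLp 2 (fun _ : Fin n => H)) i,
      matrixOp (x.map fun a : E => (a : H →L[ℂ] K)) h i = ∑ j, (x i j : H →L[ℂ] K) (h j) := by
    intro h i
    simp [matrixOp]
  have hsq : ∀ h : PiLp 2 (fun _ : Fin n => H),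
      ‖matrixOp (x.map fun a : E => (a : H →L[ℂ] K)) h‖ ≤ c * ‖h‖ ↔
        ∑ i, ‖∑ j, (x i j : H →L[ℂ] K) (h j)‖ ^ 2 ≤ c ^ 2 * ∑ j, ‖h j‖ ^ 2 := by
    intro h
    rw [← abs_of_nonneg (norm_nonneg (matrixOp _ h)), ← abs_of_nonneg (by positivity : 0 ≤ c * ‖h‖),
      ← sq_le_sq, mul_pow, PiLp.norm_sq_eq_of_L2, PiLp.norm_sq_eq_of_L2]
    simp only [hval]
  rw [matrixNorm, ← ofReal_norm, ENNReal.ofReal_le_ofReal_iff hc,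
    ContinuousLinearMap.opNorm_le_iff hc]
  simp only [hsq]
  exact ⟨fun h g => h (WithLp.toLp 2 g), fun h g => h _⟩

theorem cbNorm_le {E : Submodule ℂ (H₁ →L[ℂ] K₁)} {F : Submodule ℂ (H₂ →L[ℂ] K₂)} {u : E →ₗ[ℂ] F}
    {k : ℝ} (hk : 0 ≤ k)
    (h : ∀ (n : ℕ) (x : Fin n → Fin n → E), MatBound (fun i j => (x i j : H₁ →L[ℂ] K₁)) 1 →
      MatBound (fun i j => (u (x i j) : H₂ →L[ℂ] K₂)) k) :
    cbNorm u ≤ ENNReal.ofReal k := by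
  refine iSup_le fun n => iSup_le fun x => iSup_le fun hx => ?_
  rw [matrixNorm_le_iff hk]
  exact h n x ((matrixNorm_le_iff zero_le_one).1 (by simpa using hx))

theorem IsCB.matBound {E : Submodule ℂ (H₁ →L[ℂ] K₁)} {F : Submodule ℂ (H₂ →L[ℂ] K₂)}
    {u : E →ₗ[ℂ] F} (hu : IsCB u) {x : Fin n → Fin n → E}
    (hx : MatBound (fun i j => (x i j : H₁ →L[ℂ] K₁)) 1) :
    MatBound (fun i j => (u (x i j) : H₂ →L[ℂ] K₂)) (cbNorm u).toReal := by
  refine (matrixNorm_le_iff (x := Matrix.map (Matrix.of x) u) ENNReal.toReal_nonneg).1 ?_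
  rw [ENNReal.ofReal_toReal hu.ne]
  refine le_iSup_of_le n (le_iSup_of_le (Matrix.of x) (le_iSup_of_le ?_ le_rfl))
  have := (matrixNorm_le_iff (x := Matrix.of x) zero_le_one).2 hx
  simpa using this

/-- The norm of a matrix of block diagonal operators whose first blocks have rank one with the same
range, and whose second blocks have rank one with the same kernel. -/
theorem matBound_iff [CompleteSpace H₁] {k₁ : K₁} {k₂ : H₂} (hk₁ : ‖k₁‖ = 1) (hk₂ : ‖k₂‖ = 1)
    {X : Fin n → Fin n → WithLp 2 (H₁ × H₂) →L[ℂ] WithLp 2 (K₁ × K₂)}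
    {φ : Fin n → Fin n → StrongDual ℂ H₁} {y : Fin n → Fin n → K₂}
    (hX : ∀ i j h, X i j h = WithLp.toLp 2 (φ i j h.fst • k₁, ⟪k₂, h.snd⟫_ℂ • y i j)) {c : ℝ} :
    MatBound X c ↔ RowBound φ c ∧ ColBound y c := by
  have hval : ∀ h : Fin n → WithLp 2 (H₁ × H₂), ∑ i, ‖∑ j, X i j (h j)‖ ^ 2 =
      ∑ i, ‖∑ j, φ i j (h j).fst‖ ^ 2 + ∑ i, ‖∑ j, ⟪k₂, (h j).snd⟫_ℂ • y i j‖ ^ 2 := by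
    intro h
    rw [← Finset.sum_add_distrib]
    refine Finset.sum_congr rfl fun i _ => ?_
    have : ∑ j, X i j (h j) =
        WithLp.toLp 2 ((∑ j, φ i j (h j).fst) • k₁, ∑ j, ⟪k₂, (h j).snd⟫_ℂ • y i j) := by
      simp only [hX, ← WithLp.toLp_sum, Finset.sum_smul]
      exact congrArg _ (Prod.ext Prod.fst_sum Prod.snd_sum)
    rw [this, WithLp.prod_norm_sq_eq_of_L2]
    simp [norm_smul, hk₁]
  have hdom : ∀ h : Fin n → WithLp 2 (H₁ × H₂), ∑ j, ‖h j‖ ^ 2 =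
      ∑ j, ‖(h j).fst‖ ^ 2 + ∑ j, ‖(h j).snd‖ ^ 2 := by
    intro h
    simp only [WithLp.prod_norm_sq_eq_of_L2, Finset.sum_add_distrib]
  constructor
  · intro hM
    constructor
    · intro η
      -- Duality: the matrix is tested on the Riesz representatives of the combinations ψ j. Pairing
      -- the output with η returns q = ∑ ‖ψ j‖², and Cauchy–Schwarz gives q² ≤ ‖η‖² c² q.
      set ψ : Fin n → StrongDual ℂ H₁ := fun j => ∑ i, η i • φ i j with hψ
      set g : Fin n → H₁ := fun j => (InnerProductSpace.toDual ℂ H₁).symm (ψ j) with hg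
      have h1 := hM fun j => WithLp.toLp 2 (g j, 0)
      rw [hval, hdom] at h1
      have hgn : ∀ j, ‖g j‖ = ‖ψ j‖ := fun j => by simp [hg]
      simp only [WithLp.toLp_fst, WithLp.toLp_snd, inner_zero_right, zero_smul, Finset.sum_const_zero, norm_zero, ne_eq,
        OfNat.ofNat_ne_zero, not_false_eq_true, zero_pow, add_zero, hgn] at h1
      set q := ∑ j, ‖ψ j‖ ^ 2 with hq
      have hq0 : 0 ≤ q := Finset.sum_nonneg fun _ _ => sq_nonneg _
      have hψg : ∀ j, ψ j (g j) = ((‖ψ j‖ ^ 2 : ℝ) : ℂ) := fun j => by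
        have : ψ j (g j) = ⟪g j, g j⟫_ℂ := by
          rw [← InnerProductSpace.toDual_apply_apply (𝕜 := ℂ)]; simp [hg]
        rw [this, inner_self_eq_norm_sq_to_K, hgn]; simp
      have hs : ∑ i, η i * ∑ j, φ i j (g j) = ((q : ℝ) : ℂ) := by
        rw [hq, Complex.ofReal_sum, ← Finset.sum_congr rfl fun j _ => hψg j]
        simp only [hψ, sum_apply, smul_apply,
          smul_eq_mul, Finset.mul_sum]
        exact Finset.sum_comm
      have h2 : q ≤ ∑ i, ‖η i‖ * ‖∑ j, φ i j (g j)‖ := by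
        calc q = ‖((q : ℝ) : ℂ)‖ := by simp [abs_of_nonneg hq0]
          _ ≤ _ := by rw [← hs]; exact (norm_sum_le _ _).trans_eq (by simp only [norm_mul])
      have h3 : q ^ 2 ≤ (∑ i, ‖η i‖ ^ 2) * (c ^ 2 * q) :=
        calc q ^ 2 ≤ (∑ i, ‖η i‖ * ‖∑ j, φ i j (g j)‖) ^ 2 := by gcongr
          _ ≤ (∑ i, ‖η i‖ ^ 2) * ∑ i, ‖∑ j, φ i j (g j)‖ ^ 2 :=
            Finset.sum_mul_sq_le_sq_mul_sq _ _ _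
          _ ≤ _ := by gcongr
      show q ≤ _
      rcases hq0.eq_or_lt with h0 | h0
      · rw [← h0]; positivity
      · nlinarith
    · intro ξ
      have h1 := hM fun j => WithLp.toLp 2 (0, ξ j • k₂)
      rw [hval, hdom] at h1
      simpa [norm_smul, hk₂, inner_smul_right, inner_self_eq_norm_sq_to_K] using h1
  · rintro ⟨hr, hcol⟩ h
    rw [hval, hdom, mul_add]
    refine add_le_add ?_ ?_
    -- The same duality in reverse: the row bound is tested on the conjugate of the output z.
    · set z : Fin n → ℂ := fun i => ∑ j, φ i j (h j).fst with hz
      have h1 := hr fun i => star (z i)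
      simp only [norm_star] at h1
      set q := ∑ i, ‖z i‖ ^ 2 with hq
      have hq0 : 0 ≤ q := Finset.sum_nonneg fun _ _ => sq_nonneg _
      set ψ : Fin n → StrongDual ℂ H₁ := fun j => ∑ i, star (z i) • φ i j with hψ
      have hs : ((q : ℝ) : ℂ) = ∑ j, ψ j (h j).fst := by
        have h2 : ((q : ℝ) : ℂ) = ∑ i, star (z i) * ∑ j, φ i j (h j).fst := by
          rw [hq, Complex.ofReal_sum]
          refine Finset.sum_congr rfl fun i _ => ?_
          have := Complex.conj_mul' (z i)
          simpa using this.symm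
        rw [h2]
        simp only [hψ, sum_apply, smul_apply,
          smul_eq_mul, Finset.mul_sum]
        exact Finset.sum_comm
      have h2 : q ≤ ∑ j, ‖ψ j‖ * ‖(h j).fst‖ := by
        calc q = ‖((q : ℝ) : ℂ)‖ := by simp [abs_of_nonneg hq0]
          _ ≤ ∑ j, ‖ψ j (h j).fst‖ := by rw [hs]; exact norm_sum_le _ _
          _ ≤ _ := Finset.sum_le_sum fun j _ => (ψ j).le_opNorm _
      have h3 : q ^ 2 ≤ (c ^ 2 * q) * ∑ j, ‖(h j).fst‖ ^ 2 :=
        calc q ^ 2 ≤ (∑ j, ‖ψ j‖ * ‖(h j).fst‖) ^ 2 := by gcongr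
          _ ≤ (∑ j, ‖ψ j‖ ^ 2) * ∑ j, ‖(h j).fst‖ ^ 2 := Finset.sum_mul_sq_le_sq_mul_sq _ _ _
          _ ≤ _ := by gcongr
      rcases hq0.eq_or_lt with h0 | h0
      · rw [← h0]; positivity
      · nlinarith
    · refine (hcol fun j => ⟪k₂, (h j).snd⟫_ℂ).trans ?_
      gcongr with j
      simpa [hk₂] using norm_inner_le_norm (𝕜 := ℂ) k₂ (h j).snd

end Norms

/-! ### Splitting a Hilbert space by the sign of α†α - β†β -/

section Splitting

variable {V X Y : Type*} [NormedAddCommGroup V] [InnerProductSpace ℂ V]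
  [NormedAddCommGroup X] [InnerProductSpace ℂ X] [NormedAddCommGroup Y] [InnerProductSpace ℂ Y]

/-- The kernel of the positive part of `α† α - β† β` splits `V` into two parts on which `α`,
respectively `β`, dominates. -/
theorem exists_splitting [CompleteSpace V] [CompleteSpace X] [CompleteSpace Y] (α : V →L[ℂ] X)
    (β : V →L[ℂ] Y) (h : ∀ v w, ⟪v, w⟫_ℂ = ⟪α v, α w⟫_ℂ + ⟪β v, β w⟫_ℂ) :
    ∃ N : Submodule ℂ V, IsClosed (N : Set V) ∧
      (∀ v ∈ Nᗮ, ‖β v‖ ≤ ‖α v‖) ∧ (∀ v ∈ N, ‖α v‖ ≤ ‖β v‖) ∧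
      ∀ v ∈ Nᗮ, ∀ w ∈ N, ⟪α v, α w⟫_ℂ = 0 ∧ ⟪β v, β w⟫_ℂ = 0 := by
  set T : V →L[ℂ] V := α.adjoint ∘L α - β.adjoint ∘L β with hT
  have hTin : ∀ v w, ⟪T v, w⟫_ℂ = ⟪α v, α w⟫_ℂ - ⟪β v, β w⟫_ℂ := fun v w => by
    rw [hT, sub_apply, inner_sub_left]
    simp [ContinuousLinearMap.adjoint_inner_left]
  have hsa : IsSelfAdjoint T :=
    (ContinuousLinearMap.isPositive_adjoint_comp_self α).isSelfAdjoint.sub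
      (ContinuousLinearMap.isPositive_adjoint_comp_self β).isSelfAdjoint
  have hp : (T⁺).IsPositive := (ContinuousLinearMap.nonneg_iff_isPositive _).1 (CFC.posPart_nonneg T)
  have hn : (T⁻).IsPositive := (ContinuousLinearMap.nonneg_iff_isPositive _).1 (CFC.negPart_nonneg T)
  have hsub : ∀ v, T v = T⁺ v - T⁻ v := fun v => by
    rw [← sub_apply, CFC.posPart_sub_negPart T hsa]
  have hmul : ∀ v, T⁺ (T⁻ v) = 0 := fun v => by
    rw [← mul_apply_eq_comp, CFC.posPart_mul_negPart, zero_apply]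
  -- T⁻ maps into ker T⁺ and is symmetric, so it kills the orthogonal complement of ker T⁺.
  have hneg : ∀ v ∈ (T⁺ : V →L[ℂ] V).kerᗮ, T⁻ v = 0 := fun v hv => by
    rw [← inner_self_eq_zero (𝕜 := ℂ)]
    exact (hn.isSymmetric v (T⁻ v)).trans
      (Submodule.inner_left_of_mem_orthogonal (K := (T⁺ : V →L[ℂ] V).ker) (hmul _) hv)
  have hre : ∀ v, RCLike.re ⟪T v, v⟫_ℂ = ‖α v‖ ^ 2 - ‖β v‖ ^ 2 := fun v => by
    rw [hTin, map_sub, inner_self_eq_norm_sq, inner_self_eq_norm_sq]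
  refine ⟨(T⁺ : V →L[ℂ] V).ker, (T⁺ : V →L[ℂ] V).isClosed_ker, fun v hv => ?_, fun v hv => ?_,
    fun v hv w hw => ?_⟩
  · have h1 := hp.re_inner_nonneg_left v
    have h2 := hre v
    rw [hsub, hneg v hv, sub_zero] at h2
    exact abs_le_of_sq_le_sq' (by linarith) (norm_nonneg _) |>.2
  · have h1 := hn.re_inner_nonneg_left v
    have h2 := hre v
    have h3 : T⁺ v = 0 := hv
    rw [hsub, h3, zero_sub, inner_neg_left, map_neg] at h2
    exact abs_le_of_sq_le_sq' (by linarith) (norm_nonneg _) |>.2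
  -- ⟪T v, w⟫ = ⟪v, T⁺ w⟫ = 0 makes the two inner products equal, while ⟪v, w⟫ = 0 makes their sum
  -- vanish.
  · have h1 := hTin v w
    have h3 : T⁺ w = 0 := hw
    have h4 : ⟪T⁺ v, w⟫_ℂ = ⟪v, T⁺ w⟫_ℂ := hp.isSymmetric v w
    rw [hsub, hneg v hv, sub_zero, h4, h3, inner_zero_right] at h1
    have h2 := h v w
    rw [Submodule.inner_left_of_mem_orthogonal hw hv] at h2
    constructor
    · linear_combination (-1 / 2 : ℂ) * h2 - (1 / 2 : ℂ) * h1
    · linear_combination (-1 / 2 : ℂ) * h2 + (1 / 2 : ℂ) * h1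

/-- If the identity of `V` is a sum `p + q`, where `β p` is square summable (with bound `M`) on
the families that are bounded under `α`, and `α q` on those that are bounded under `β`, then `β` is
square summable on the range of any projection `π` that is dominated by `α`. -/
theorem sum_sq_le_of_decomposition {α : V →ₗ[ℂ] X} {β : V →ₗ[ℂ] Y} {p q : V → V} {M : ℝ} {n : ℕ}
    (hα : ∀ v, ‖α v‖ ≤ ‖v‖) (hβ : ∀ v, ‖β v‖ ≤ ‖v‖) (hpq : ∀ v, p v + q v = v)
    (hp : ∀ v : Fin n → V, (∀ η : Fin n → ℂ, ‖∑ i, η i • α (v i)‖ ^ 2 ≤ ∑ i, ‖η i‖ ^ 2) →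
      ∑ i, ‖β (p (v i))‖ ^ 2 ≤ M ^ 2)
    (hq : ∀ v : Fin n → V, (∀ η : Fin n → ℂ, ‖∑ i, η i • β (v i)‖ ^ 2 ≤ ∑ i, ‖η i‖ ^ 2) →
      ∑ i, ‖α (q (v i))‖ ^ 2 ≤ M ^ 2)
    (π : V →ₗ[ℂ] V) (hπα : ∀ v, ‖π v‖ ^ 2 ≤ 2 * ‖α v‖ ^ 2) (hπβ : ∀ v, ‖β (π v)‖ ≤ ‖β v‖)
    {v : Fin n → V} (hπ : ∀ i, π (v i) = v i)
    (hv : ∀ η : Fin n → ℂ, ‖∑ i, η i • v i‖ ^ 2 ≤ ∑ i, ‖η i‖ ^ 2) :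
    ∑ i, ‖β (v i)‖ ^ 2 ≤ (3 * M) ^ 2 := by
  have h1 := hp v fun η => by
    simp only [← map_smul, ← map_sum]
    exact (pow_le_pow_left₀ (norm_nonneg _) (hα _) 2).trans (hv η)
  have h2 := hq v fun η => by
    simp only [← map_smul, ← map_sum]
    exact (pow_le_pow_left₀ (norm_nonneg _) (hβ _) 2).trans (hv η)
  -- Apply βπ to v = p v + q v, using ‖βπq v‖² ≤ ‖πq v‖² ≤ 2‖αq v‖². Summation gives 2M² + 4M² ≤
  -- (3M)².
  have hi : ∀ i, ‖β (v i)‖ ^ 2 ≤ 2 * ‖β (p (v i))‖ ^ 2 + 4 * ‖α (q (v i))‖ ^ 2 := fun i => by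
    have h3 : β (v i) = β (π (p (v i))) + β (π (q (v i))) := by
      rw [← map_add, ← map_add, hpq, hπ]
    have h4 : ‖β (v i)‖ ≤ ‖β (p (v i))‖ + ‖π (q (v i))‖ := by
      rw [h3]
      exact (norm_add_le _ _).trans (add_le_add (hπβ _) (hβ _))
    nlinarith [hπα (q (v i)), sq_nonneg (‖β (p (v i))‖ - ‖π (q (v i))‖), norm_nonneg (β (v i))]
  calc _ ≤ ∑ i, (2 * ‖β (p (v i))‖ ^ 2 + 4 * ‖α (q (v i))‖ ^ 2) := Finset.sum_le_sum fun i _ => hi i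
    _ ≤ (3 * M) ^ 2 := by
      rw [Finset.sum_add_distrib, ← Finset.mul_sum, ← Finset.mul_sum]
      nlinarith [sq_nonneg M]

/-- The subspaces `Nᗮ` and `N` of `V`, in the row and column structure, reproduce the structure
that `α` and `β` induce on `V`. -/
theorem exists_row_col_splitting [CompleteSpace V] [CompleteSpace X] [CompleteSpace Y]
    (α : V →L[ℂ] X) (β : V →L[ℂ] Y) (h : ∀ v w, ⟪v, w⟫_ℂ = ⟪α v, α w⟫_ℂ + ⟪β v, β w⟫_ℂ)
    {p q : V → V} {M : ℝ} (hM : 0 ≤ M) (hpq : ∀ v, p v + q v = v)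
    (hp : ∀ (n : ℕ) (v : Fin n → V),
      (∀ η : Fin n → ℂ, ‖∑ i, η i • α (v i)‖ ^ 2 ≤ ∑ i, ‖η i‖ ^ 2) →
      ∑ i, ‖β (p (v i))‖ ^ 2 ≤ M ^ 2)
    (hq : ∀ (n : ℕ) (v : Fin n → V),
      (∀ η : Fin n → ℂ, ‖∑ i, η i • β (v i)‖ ^ 2 ≤ ∑ i, ‖η i‖ ^ 2) →
      ∑ i, ‖α (q (v i))‖ ^ 2 ≤ M ^ 2) :
    ∃ N : Submodule ℂ V, IsClosed (N : Set V) ∧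
      ∀ (n : ℕ) (e : Fin n → Fin n → Nᗮ) (f : Fin n → Fin n → N),
        (RowBound (fun i j => α (e i j + f i j)) 1 → RowBound e 2) ∧
        (ColBound (fun i j => β (e i j + f i j)) 1 → ColBound f 2) ∧
        (RowBound e 1 → ColBound f 1 → RowBound (fun i j => α (e i j + f i j)) (1 + 3 * M) ∧
          ColBound (fun i j => β (e i j + f i j)) (1 + 3 * M)) := by
  obtain ⟨N, hN, hE, hF, horth⟩ := exists_splitting α β h
  refine ⟨N, hN, ?_⟩
  have : CompleteSpace N := hN.completeSpace_coe
  have hsq : ∀ v, ‖v‖ ^ 2 = ‖α v‖ ^ 2 + ‖β v‖ ^ 2 := fun v => by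
    rw [← inner_self_eq_norm_sq (𝕜 := ℂ), h, map_add, inner_self_eq_norm_sq, inner_self_eq_norm_sq]
  have hα : ∀ v, ‖α v‖ ≤ ‖v‖ := fun v =>
    (abs_le_of_sq_le_sq' (by nlinarith [hsq v]) (norm_nonneg _)).2
  have hβ : ∀ v, ‖β v‖ ≤ ‖v‖ := fun v =>
    (abs_le_of_sq_le_sq' (by nlinarith [hsq v]) (norm_nonneg _)).2
  have hαadd : ∀ (e : Nᗮ) (f : N), ‖α (e + f)‖ ^ 2 = ‖α e‖ ^ 2 + ‖α f‖ ^ 2 := fun e f => by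
    have := norm_add_sq_eq_norm_sq_add_norm_sq_of_inner_eq_zero (𝕜 := ℂ) (α e) (α f)
      (horth e e.2 f f.2).1
    rw [map_add, sq, sq, sq, this]
  have hβadd : ∀ (e : Nᗮ) (f : N), ‖β (e + f)‖ ^ 2 = ‖β e‖ ^ 2 + ‖β f‖ ^ 2 := fun e f => by
    have := norm_add_sq_eq_norm_sq_add_norm_sq_of_inner_eq_zero (𝕜 := ℂ) (β e) (β f)
      (horth e e.2 f f.2).2
    rw [map_add, sq, sq, sq, this]
  -- On Nᗮ the term ‖β e‖² is absorbed into ‖α e‖²; orthogonality of α e and α f then allows any f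
  -- to be added.
  have hE2 : ∀ (e : Nᗮ) (f : N), ‖e‖ ^ 2 ≤ 2 * ‖α (e + f)‖ ^ 2 := fun e f => by
    have h1 := hsq e
    have h2 := pow_le_pow_left₀ (norm_nonneg _) (hE e e.2) 2
    rw [hαadd]
    simp only [Submodule.coe_norm] at *
    nlinarith [sq_nonneg ‖α f‖]
  have hF2 : ∀ (e : Nᗮ) (f : N), ‖f‖ ^ 2 ≤ 2 * ‖β (e + f)‖ ^ 2 := fun e f => by
    have h1 := hsq f
    have h2 := pow_le_pow_left₀ (norm_nonneg _) (hF f f.2) 2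
    rw [hβadd]
    simp only [Submodule.coe_norm] at *
    nlinarith [sq_nonneg ‖β e‖]
  have hadd : ∀ v, ∃ (e : Nᗮ) (f : N), v = (e : V) + (f : V) ∧ Nᗮ.starProjection v = e ∧
      N.starProjection v = f := fun v =>
    ⟨Nᗮ.orthogonalProjectionOnto v, N.orthogonalProjectionOnto v, by
      rw [add_comm]
      exact (N.starProjection_add_starProjection_orthogonal v).symm, rfl, rfl⟩
  let s : (Nᗮ × N) →ₗ[ℂ] V := Nᗮ.subtype.coprod N.subtype
  have hβE : ∀ (n : ℕ) (v : Fin n → Nᗮ),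
      (∀ η : Fin n → ℂ, ‖∑ i, η i • v i‖ ^ 2 ≤ ∑ i, ‖η i‖ ^ 2) →
      ∑ i, ‖β (v i)‖ ^ 2 ≤ (3 * M) ^ 2 := fun n v hv => by
    refine sum_sq_le_of_decomposition (α := (α : V →ₗ[ℂ] X)) (β := (β : V →ₗ[ℂ] Y)) (p := p) (q := q)
      hα hβ hpq (hp n) (hq n) (Nᗮ.starProjection : V →L[ℂ] V).toLinearMap ?_ ?_
      (v := fun i => (v i : V)) ?_ ?_
    · intro v
      obtain ⟨e, f, rfl, he, -⟩ := hadd v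
      exact (congrArg (fun w => ‖w‖ ^ 2) he).trans_le (hE2 e f)
    · intro v
      obtain ⟨e, f, rfl, he, -⟩ := hadd v
      refine (congrArg (fun w => ‖β w‖) he).trans_le ?_
      exact (abs_le_of_sq_le_sq' ((le_add_of_nonneg_right (sq_nonneg _)).trans_eq (hβadd e f).symm)
        (norm_nonneg _)).2
    · exact fun i => Submodule.starProjection_eq_self_iff.2 (v i).2
    · intro η
      have := hv η
      rw [Submodule.coe_norm] at this
      simpa using this
  have hαF : ∀ (n : ℕ) (v : Fin n → N),
      (∀ η : Fin n → ℂ, ‖∑ i, η i • v i‖ ^ 2 ≤ ∑ i, ‖η i‖ ^ 2) →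
      ∑ i, ‖α (v i)‖ ^ 2 ≤ (3 * M) ^ 2 := fun n v hv => by
    refine sum_sq_le_of_decomposition (α := (β : V →ₗ[ℂ] Y)) (β := (α : V →ₗ[ℂ] X)) (p := q) (q := p)
      hβ hα (fun v => (add_comm _ _).trans (hpq v)) (hq n) (hp n)
      (N.starProjection : V →L[ℂ] V).toLinearMap ?_ ?_ (v := fun i => (v i : V)) ?_ ?_
    · intro v
      obtain ⟨e, f, rfl, -, hf⟩ := hadd v
      exact (congrArg (fun w => ‖w‖ ^ 2) hf).trans_le (hF2 e f)
    · intro v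
      obtain ⟨e, f, rfl, -, hf⟩ := hadd v
      refine (congrArg (fun w => ‖α w‖) hf).trans_le ?_
      exact (abs_le_of_sq_le_sq' ((le_add_of_nonneg_left (sq_nonneg _)).trans_eq (hαadd e f).symm)
        (norm_nonneg _)).2
    · exact fun i => Submodule.starProjection_eq_self_iff.2 (v i).2
    · intro η
      have := hv η
      rw [Submodule.coe_norm] at this
      simpa using this
  intro n e f
  refine ⟨fun hr => ?_, fun hc => ?_, fun hr hc => ⟨?_, ?_⟩⟩
  · have := ColBound.of_norm_le (LinearMap.fst ℂ Nᗮ N) ((α : V →ₗ[ℂ] X) ∘ₗ s) (k := 2)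
      (fun u => (hE2 u.1 u.2).trans (mul_le_mul_of_nonneg_right (by norm_num) (sq_nonneg _)))
      (x := fun i j => (e j i, f j i)) hr
    rwa [mul_one] at this
  · have := ColBound.of_norm_le (LinearMap.snd ℂ Nᗮ N) ((β : V →ₗ[ℂ] Y) ∘ₗ s) (k := 2)
      (fun u => (hF2 u.1 u.2).trans (mul_le_mul_of_nonneg_right (by norm_num) (sq_nonneg _)))
      (x := fun i j => (e i j, f i j)) hc
    rwa [mul_one] at this
  -- The constant 1 + 3M: α is a contraction on the row component and Hilbert–Schmidt on the column
  -- component. Row bounds are handled as column bounds of the transpose.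
  · have h1 := ColBound.of_norm_le ((α : V →ₗ[ℂ] X) ∘ₗ Nᗮ.subtype) LinearMap.id (k := 1)
      (fun u => by rw [one_pow, one_mul]; exact pow_le_pow_left₀ (norm_nonneg _) (hα u) 2)
      (x := fun i j => e j i) hr
    have h2 := colBound_of_rowBound ((α : V →ₗ[ℂ] X) ∘ₗ N.subtype) (hαF n)
      (x := fun i j => f j i) hc
    have h3 := ColBound.add h1 h2 (by norm_num) (by positivity)
    rw [mul_one] at h3
    simpa [RowBound] using h3
  · have h1 := ColBound.of_norm_le ((β : V →ₗ[ℂ] Y) ∘ₗ N.subtype) LinearMap.id (k := 1)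
      (fun u => by rw [one_pow, one_mul]; exact pow_le_pow_left₀ (norm_nonneg _) (hβ u) 2)
      (x := f) hc
    have h2 := colBound_of_rowBound ((β : V →ₗ[ℂ] Y) ∘ₗ Nᗮ.subtype) (hβE n) (x := e) hr
    have h3 := ColBound.add h1 h2 (by norm_num) (by positivity)
    rw [mul_one] at h3
    simpa [add_comm] using h3

end Splitting

/-! ### Coordinates on `H_r ⊕ K_c` -/

theorem blockDiag_injective {H₁ K₁ H₂ K₂ : Type*}
    [NormedAddCommGroup H₁] [InnerProductSpace ℂ H₁] [NormedAddCommGroup K₁]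
    [InnerProductSpace ℂ K₁] [NormedAddCommGroup H₂] [InnerProductSpace ℂ H₂]
    [NormedAddCommGroup K₂] [InnerProductSpace ℂ K₂] :
    Function.Injective (blockDiag (H₁ := H₁) (K₁ := K₁) (H₂ := H₂) (K₂ := K₂)) := by
  rintro ⟨A, B⟩ ⟨A', B'⟩ h
  have happ := fun z : WithLp 2 (H₁ × H₂) => DFunLike.congr_fun h z
  refine Prod.ext (ContinuousLinearMap.ext fun x => ?_) (ContinuousLinearMap.ext fun y => ?_)
  · exact congrArg WithLp.fst (happ (WithLp.toLp 2 (x, 0)))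
  · exact congrArg WithLp.snd (happ (WithLp.toLp 2 (0, y)))

section RowColumnSum

variable (H K : Type*) [NormedAddCommGroup H] [InnerProductSpace ℂ H] [CompleteSpace H]
  [NormedAddCommGroup K] [InnerProductSpace ℂ K]

/-- A Hilbert space is its own bidual. -/
def bidualEquiv : H ≃ₗ[ℂ] (StrongDual ℂ H →L[ℂ] ℂ) :=
  LinearEquiv.ofBijective (NormedSpace.inclusionInDoubleDualLi ℂ (E := H)).toLinearMap
    ⟨(NormedSpace.inclusionInDoubleDualLi ℂ (E := H)).injective, fun Ψ => by
      set f : StrongDual ℂ H := (InnerProductSpace.toDual ℂ (StrongDual ℂ H)).symm Ψ with hf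
      refine ⟨(InnerProductSpace.toDual ℂ H).symm f, ?_⟩
      ext g
      have h1 : Ψ g = ⟪f, g⟫_ℂ :=
        (InnerProductSpace.toDual_symm_apply (𝕜 := ℂ) (E := StrongDual ℂ H)).symm
      have h2 : ⟪f, g⟫_ℂ = ⟪(InnerProductSpace.toDual ℂ H).symm g,
        (InnerProductSpace.toDual ℂ H).symm f⟫_ℂ := rfl
      rw [h1, h2, InnerProductSpace.toDual_symm_apply]
      rfl⟩

variable {H} in
theorem rowBound_bidualEquiv_iff {n : ℕ} {x : Fin n → Fin n → H} {c : ℝ} :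
    RowBound (fun i j => bidualEquiv H (x i j)) c ↔ RowBound x c := by
  have hn : ∀ v : H, ‖bidualEquiv H v‖ = ‖v‖ := (NormedSpace.inclusionInDoubleDualLi ℂ).norm_map
  simp only [RowBound, ColBound, ← map_smul, ← map_sum, hn]

/-- The elements of `H_r ⊕ K_c` are given by pairs of vectors. -/
def rowColEquiv : (H × K) ≃ₗ[ℂ] directSum (rowSpace H) (colSpace K) :=
  ((bidualEquiv H).prodCongr (ContinuousLinearMap.toSpanSingletonLE ℂ ℂ K)).trans
    (LinearEquiv.ofBijective
      (blockDiag.codRestrict (directSum (rowSpace H) (colSpace K))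
        fun T => ⟨T, ⟨trivial, trivial⟩, rfl⟩)
      ⟨fun _ _ h => blockDiag_injective (congrArg Subtype.val h), fun ⟨_, T, _, h⟩ =>
        ⟨T, Subtype.ext h⟩⟩)

theorem rowColEquiv_apply (u : H × K) (h : WithLp 2 (StrongDual ℂ H × ℂ)) :
    (rowColEquiv H K u : WithLp 2 (StrongDual ℂ H × ℂ) →L[ℂ] WithLp 2 (ℂ × K)) h =
      WithLp.toLp 2 (bidualEquiv H u.1 h.fst, h.snd • u.2) := rfl

variable {H K} in
theorem matBound_rowColEquiv_iff {n : ℕ} {x : Fin n → Fin n → H} {y : Fin n → Fin n → K} {c : ℝ} :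
    MatBound (fun i j => (rowColEquiv H K (x i j, y i j) :
      WithLp 2 (StrongDual ℂ H × ℂ) →L[ℂ] WithLp 2 (ℂ × K))) c ↔ RowBound x c ∧ ColBound y c := by
  rw [← rowBound_bidualEquiv_iff]
  exact matBound_iff (k₁ := (1 : ℂ)) (k₂ := (1 : ℂ)) (by simp) (by simp)
    fun i j h => by rw [rowColEquiv_apply]; simp

end RowColumnSum

/-- The space on which the elements of `R ⊕ C` act. -/
local notation "𝓗" => WithLp 2 (EllTwo × EllTwo)

/-! ### Coordinates on `R ⊕ C` -/

section Ambient

theorem norm_basisVec (i : ℕ) : ‖basisVec i‖ = 1 := by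
  rw [basisVec, lp.norm_single (by norm_num)]
  simp

/-- The functional that describes the row block of an element of `R ⊕ C`. -/
def rowPart : (𝓗 →L[ℂ] 𝓗) →L[ℂ] StrongDual ℂ EllTwo :=
  (ContinuousLinearMap.precomp ℂ ((WithLp.prodContinuousLinearEquiv 2 ℂ EllTwo EllTwo).symm.toContinuousLinearMap ∘L
      ContinuousLinearMap.inl ℂ EllTwo EllTwo)) ∘L
    (ContinuousLinearMap.postcomp 𝓗 (innerSL ℂ (basisVec 0) ∘L WithLp.fstL 2 ℂ EllTwo EllTwo))

/-- The vector that describes the column block of an element of `R ⊕ C`. -/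
def colPart : (𝓗 →L[ℂ] 𝓗) →L[ℂ] EllTwo :=
  WithLp.sndL 2 ℂ EllTwo EllTwo ∘L ContinuousLinearMap.apply ℂ 𝓗 (WithLp.toLp 2 (0, basisVec 0))

/-- The relation A = e₀₀A is closed and holds for the matrix units of the first row. -/
theorem apply_of_mem_R {r : EllTwo →L[ℂ] EllTwo} (hr : r ∈ R) (z : EllTwo) :
    r z = ⟪basisVec 0, r z⟫_ℂ • basisVec 0 := by
  let D : (EllTwo →L[ℂ] EllTwo) →L[ℂ] (EllTwo →L[ℂ] EllTwo) :=
    ContinuousLinearMap.id ℂ _ - ContinuousLinearMap.postcomp EllTwo (matrixUnit 0 0)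
  have hle : R ≤ D.ker := by
    refine Submodule.topologicalClosure_minimal _ (Submodule.span_le.2 ?_) D.isClosed_ker
    rintro _ ⟨j, rfl⟩
    refine sub_eq_zero.2 ?_
    ext1 w
    simp [matrixUnit, inner_self_eq_norm_sq_to_K, norm_basisVec]
  exact congrArg (fun A : EllTwo →L[ℂ] EllTwo => A z) (sub_eq_zero.1 (hle hr))

/-- The relation A = Ae₀₀ is closed and holds for the matrix units of the first column. -/
theorem apply_of_mem_C {c : EllTwo →L[ℂ] EllTwo} (hc : c ∈ C) (z : EllTwo) :
    c z = ⟪basisVec 0, z⟫_ℂ • c (basisVec 0) := by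
  let D : (EllTwo →L[ℂ] EllTwo) →L[ℂ] (EllTwo →L[ℂ] EllTwo) :=
    ContinuousLinearMap.id ℂ _ - ContinuousLinearMap.precomp EllTwo (matrixUnit 0 0)
  have hle : C ≤ D.ker := by
    refine Submodule.topologicalClosure_minimal _ (Submodule.span_le.2 ?_) D.isClosed_ker
    rintro _ ⟨j, rfl⟩
    refine sub_eq_zero.2 ?_
    ext1 w
    simp [matrixUnit, inner_self_eq_norm_sq_to_K, norm_basisVec]
  have := congrArg (fun A : EllTwo →L[ℂ] EllTwo => A z) (sub_eq_zero.1 (hle hc))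
  exact this.trans (c.map_smul _ _)

theorem apply_of_mem_directSum {T : 𝓗 →L[ℂ] 𝓗} (hT : T ∈ directSum R C) (h : 𝓗) :
    T h = WithLp.toLp 2 (rowPart T h.fst • basisVec 0, ⟪basisVec 0, h.snd⟫_ℂ • colPart T) := by
  obtain ⟨⟨r, c⟩, ⟨hr, hc⟩, rfl⟩ := hT
  have h1 : blockDiag (r, c) h = WithLp.toLp 2 (r h.fst, c h.snd) := rfl
  rw [h1, apply_of_mem_R hr, apply_of_mem_C hc]
  rfl

theorem matBound_iff_rowPart_colPart {n : ℕ} {x : Fin n → Fin n → 𝓗 →L[ℂ] 𝓗}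
    (hx : ∀ i j, x i j ∈ directSum R C) {c : ℝ} :
    MatBound x c ↔
      RowBound (fun i j => rowPart (x i j)) c ∧ ColBound (fun i j => colPart (x i j)) c :=
  matBound_iff (norm_basisVec 0) (norm_basisVec 0) fun i j h => apply_of_mem_directSum (hx i j) h

/-- The two summands lie in `R ⊕ C` but need not lie in S; applying P to them produces the
decomposition p + q of the identity of S. -/
theorem exists_add_rowPart_colPart (s : directSum R C) :
    ∃ x y : directSum R C, x + y = s ∧ rowPart x = rowPart s ∧ colPart x = 0 ∧ rowPart y = 0 ∧
      colPart y = colPart s := by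
  obtain ⟨_, ⟨r, c⟩, ⟨hr, hc⟩, rfl⟩ := s
  refine ⟨⟨blockDiag (r, 0), (r, 0), ⟨hr, zero_mem _⟩, rfl⟩,
    ⟨blockDiag (0, c), (0, c), ⟨zero_mem _, hc⟩, rfl⟩, Subtype.ext ?_, rfl, rfl, ?_, rfl⟩
  · exact (map_add blockDiag (r, 0) (0, c)).symm.trans (by simp)
  · ext z
    exact inner_zero_right (𝕜 := ℂ) (basisVec 0)

/-- This makes the Hilbert norm dominate the operator norm, so a closed S is complete in the Hilbert
norm too. -/
theorem norm_sq_le_rowPart_colPart {T : 𝓗 →L[ℂ] 𝓗} (hT : T ∈ directSum R C) :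
    ‖T‖ ^ 2 ≤ ‖rowPart T‖ ^ 2 + ‖colPart T‖ ^ 2 := by
  have h0 : 0 ≤ ‖rowPart T‖ ^ 2 + ‖colPart T‖ ^ 2 := by positivity
  refine (Real.le_sqrt (norm_nonneg _) h0).1 (T.opNorm_le_bound (Real.sqrt_nonneg _) fun h => ?_)
  refine (abs_le_of_sq_le_sq' ?_ (by positivity)).2
  rw [apply_of_mem_directSum hT, WithLp.prod_norm_sq_eq_of_L2, mul_pow, Real.sq_sqrt h0,
    WithLp.prod_norm_sq_eq_of_L2]
  simp only [WithLp.toLp_fst, WithLp.toLp_snd, norm_smul, norm_basisVec, mul_one]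
  have h2 := pow_le_pow_left₀ (norm_nonneg _) ((rowPart T).le_opNorm h.fst) 2
  have h3 := pow_le_pow_left₀ (norm_nonneg _) (norm_inner_le_norm (𝕜 := ℂ) (basisVec 0) h.snd) 2
  rw [norm_basisVec, one_mul] at h3
  nlinarith [mul_le_mul_of_nonneg_right h3 (sq_nonneg ‖colPart T‖),
    mul_nonneg (sq_nonneg ‖rowPart T‖) (sq_nonneg ‖h.snd‖),
    mul_nonneg (sq_nonneg ‖colPart T‖) (sq_nonneg ‖h.fst‖)]

end Ambient

/-! ### Standard unit vectors, and the Hilbert space behind `S` -/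

theorem sum_single_smul {V : Type*} [AddCommGroup V] [Module ℂ V] {n : ℕ} (k : Fin n)
    (g : Fin n → V) : ∑ j, (Pi.single k (1 : ℂ) : Fin n → ℂ) j • g j = g k := by
  rw [Finset.sum_eq_single k (fun j _ hj => by simp [hj]) (by simp)]
  simp

theorem sum_norm_sq_single {n : ℕ} (k : Fin n) :
    ∑ j, ‖(Pi.single k (1 : ℂ) : Fin n → ℂ) j‖ ^ 2 = 1 := by
  rw [Finset.sum_eq_single k (fun j _ hj => by simp [hj]) (by simp)]
  simp

/-- A complete normed space whose norm is dominated by that of `(A, B)`, with `A` and `B` bounded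
operators into Hilbert spaces, is parametrized by a Hilbert space. -/
theorem exists_hilbert_parametrization {E X Y : Type} [NormedAddCommGroup E]
    [NormedSpace ℂ E] [NormedAddCommGroup X] [InnerProductSpace ℂ X] [CompleteSpace X]
    [NormedAddCommGroup Y] [InnerProductSpace ℂ Y] [CompleteSpace Y] (A : E →L[ℂ] X) (B : E →L[ℂ] Y)
    {S : Submodule ℂ E} (hS : IsComplete (S : Set E))
    (h : ∀ s ∈ S, ‖s‖ ^ 2 ≤ ‖A s‖ ^ 2 + ‖B s‖ ^ 2) :
    ∃ (V : Type) (_ : NormedAddCommGroup V) (_ : InnerProductSpace ℂ V) (_ : CompleteSpace V)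
      (ε : S ≃ₗ[ℂ] V) (α : V →L[ℂ] X) (β : V →L[ℂ] Y),
      (∀ v w, ⟪v, w⟫_ℂ = ⟪α v, α w⟫_ℂ + ⟪β v, β w⟫_ℂ) ∧
      (∀ v, A (ε.symm v : E) = α v) ∧ ∀ v, B (ε.symm v : E) = β v := by
  have : CompleteSpace S := hS.completeSpace_coe
  let Φ : S →L[ℂ] WithLp 2 (X × Y) :=
    (WithLp.prodContinuousLinearEquiv 2 ℂ X Y).symm.toContinuousLinearMap ∘L (A.prod B) ∘L S.subtypeL
  -- Φ is bounded below on a complete space, so its range is closed; that range serves as V.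
  have hanti : AntilipschitzWith 1 Φ :=
    ContinuousLinearMap.antilipschitz_of_bound _ fun s => by
      refine (abs_le_of_sq_le_sq' ?_ (by positivity)).2
      rw [NNReal.coe_one, one_mul]
      exact (h s s.2).trans_eq (WithLp.prod_norm_sq_eq_of_L2 (Φ s)).symm
  have : CompleteSpace Φ.range := (hanti.isClosed_range Φ.uniformContinuous).completeSpace_coe
  let ε := LinearEquiv.ofInjective Φ.toLinearMap hanti.injective
  have hε : ∀ v, Φ (ε.symm v) = v := fun v => congrArg Subtype.val (ε.apply_symm_apply v)
  exact ⟨Φ.range, inferInstance, inferInstance, this, ε,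
    WithLp.fstL 2 ℂ _ _ ∘L Submodule.subtypeL _, WithLp.sndL 2 ℂ _ _ ∘L Submodule.subtypeL _,
    fun v w => rfl, fun v => congrArg WithLp.fst (hε v), fun v => congrArg WithLp.snd (hε v)⟩

/-! ### Completely complemented subspaces of `R ⊕ C` -/

section Complemented

variable {S : Submodule ℂ (𝓗 →L[ℂ] 𝓗)} {P : directSum R C →ₗ[ℂ] S}

/-- Completely bounded maps on `R ⊕ C` take row bounded families to families with square summable
column parts. -/
theorem IsCB.sum_sq_colPart_le (hS : S ≤ directSum R C) (hP : IsCB P) {n : ℕ}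
    {x : Fin n → directSum R C} (hcol : ∀ i, colPart (x i : 𝓗 →L[ℂ] 𝓗) = 0)
    (hrow : ∀ η : Fin n → ℂ, ‖∑ i, η i • rowPart (x i : 𝓗 →L[ℂ] 𝓗)‖ ^ 2 ≤ ∑ i, ‖η i‖ ^ 2) :
    ∑ i, ‖colPart (P (x i) : 𝓗 →L[ℂ] 𝓗)‖ ^ 2 ≤ (cbNorm P).toReal ^ 2 := by
  rcases n with _ | n
  · simp
  -- With the family placed in the first column, the row norm is ‖∑ η i • rowPart (x i)‖; the column
  -- bound of the image, tested on the first unit vector, is the Hilbert–Schmidt sum. Index 0 must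
  -- exist, hence the separate empty case.
  have h1 := hP.matBound (x := fun i j => if j = (0 : Fin (n + 1)) then x i else 0) <| by
    rw [matBound_iff_rowPart_colPart fun i j => Subtype.property _]
    refine ⟨fun η => ?_, fun ξ => ?_⟩
    · rw [Finset.sum_eq_single (0 : Fin (n + 1)) (fun j _ hj => by simp [hj]) (by simp)]
      simpa using hrow η
    · refine (Finset.sum_eq_zero fun i _ => ?_).trans_le (by positivity)
      rw [Finset.sum_eq_zero fun j _ => ?_]
      · simp
      · dsimp only
        split_ifs <;> simp [hcol]
  rw [matBound_iff_rowPart_colPart fun i j => hS (Subtype.property _)] at h1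
  have h2 := h1.2 (Pi.single 0 1)
  simpa only [sum_single_smul, sum_norm_sq_single, if_true, mul_one] using h2

/-- Completely bounded maps on `R ⊕ C` take column bounded families to families with square
summable row parts. -/
theorem IsCB.sum_sq_rowPart_le (hS : S ≤ directSum R C) (hP : IsCB P) {n : ℕ}
    {x : Fin n → directSum R C} (hrow : ∀ i, rowPart (x i : 𝓗 →L[ℂ] 𝓗) = 0)
    (hcol : ∀ η : Fin n → ℂ, ‖∑ i, η i • colPart (x i : 𝓗 →L[ℂ] 𝓗)‖ ^ 2 ≤ ∑ i, ‖η i‖ ^ 2) :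
    ∑ i, ‖rowPart (P (x i) : 𝓗 →L[ℂ] 𝓗)‖ ^ 2 ≤ (cbNorm P).toReal ^ 2 := by
  rcases n with _ | n
  · simp
  -- Here the family fills the first row, which exchanges the roles of row and column bounds.
  have h1 := hP.matBound (x := fun i j => if i = (0 : Fin (n + 1)) then x j else 0) <| by
    rw [matBound_iff_rowPart_colPart fun i j => Subtype.property _]
    refine ⟨fun η => ?_, fun ξ => ?_⟩
    · refine (Finset.sum_eq_zero fun i _ => ?_).trans_le (by positivity)
      rw [Finset.sum_eq_zero fun j _ => ?_]
      · simp
      · dsimp only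
        split_ifs <;> simp [hrow]
    · rw [Finset.sum_eq_single (0 : Fin (n + 1)) (fun j _ hj => by simp [hj]) (by simp)]
      simpa using hcol ξ
  rw [matBound_iff_rowPart_colPart fun i j => hS (Subtype.property _)] at h1
  have h2 := h1.1 (Pi.single 0 1)
  simpa only [sum_single_smul, sum_norm_sq_single, if_true, mul_one] using h2

/-- A splitting of the Hilbert space that parametrizes `S` gives a complete isomorphism. -/
theorem exists_cbNorm_le_of_splitting {V : Type*} [NormedAddCommGroup V] [InnerProductSpace ℂ V]
    [CompleteSpace V] (hS : S ≤ directSum R C) (ε : S ≃ₗ[ℂ] V) {α : V →L[ℂ] StrongDual ℂ EllTwo}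
    {β : V →L[ℂ] EllTwo} (hα : ∀ v, rowPart (ε.symm v : 𝓗 →L[ℂ] 𝓗) = α v)
    (hβ : ∀ v, colPart (ε.symm v : 𝓗 →L[ℂ] 𝓗) = β v) {N : Submodule ℂ V}
    (hN : IsClosed (N : Set V)) {M : ℝ} (hM : 0 ≤ M)
    (hbd : ∀ (n : ℕ) (e : Fin n → Fin n → Nᗮ) (f : Fin n → Fin n → N),
      (RowBound (fun i j => α (e i j + f i j)) 1 → RowBound e 2) ∧
      (ColBound (fun i j => β (e i j + f i j)) 1 → ColBound f 2) ∧
      (RowBound e 1 → ColBound f 1 → RowBound (fun i j => α (e i j + f i j)) (1 + 3 * M) ∧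
        ColBound (fun i j => β (e i j + f i j)) (1 + 3 * M))) :
    ∃ w : S ≃ₗ[ℂ] directSum (rowSpace Nᗮ) (colSpace N),
      cbNorm (w : S →ₗ[ℂ] directSum (rowSpace Nᗮ) (colSpace N)) ≤ ENNReal.ofReal 2 ∧
      cbNorm (w.symm : directSum (rowSpace Nᗮ) (colSpace N) →ₗ[ℂ] S) ≤
        ENNReal.ofReal (1 + 3 * M) := by
  have : CompleteSpace N := hN.completeSpace_coe
  let δ : (Nᗮ × N) ≃ₗ[ℂ] V :=
    Submodule.prodEquivOfIsCompl Nᗮ N (Submodule.isCompl_orthogonal (K := N)).symm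
  let w := (ε.trans δ.symm).trans (rowColEquiv Nᗮ N)
  have hw : ∀ u : Nᗮ × N, w.symm (rowColEquiv Nᗮ N u) = ε.symm (u.1 + u.2) := fun u => by
    simp [w, δ]
  refine ⟨w, cbNorm_le zero_le_two fun n s hs => ?_, cbNorm_le (by positivity)
    fun n t ht => ?_⟩
  · obtain ⟨u, rfl⟩ : ∃ u : Fin n → Fin n → Nᗮ × N, s = fun i j => ε.symm ((u i j).1 + (u i j).2) :=
      ⟨fun i j => δ.symm (ε (s i j)), by
        ext1 i; ext1 j
        exact (ε.symm_apply_eq.2 (δ.apply_symm_apply _)).symm⟩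
    rw [matBound_iff_rowPart_colPart fun i j => hS (Subtype.property _)] at hs
    simp only [hα, hβ] at hs
    have hb := hbd n (fun i j => (u i j).1) (fun i j => (u i j).2)
    have h1 := matBound_rowColEquiv_iff.2 ⟨hb.1 hs.1, hb.2.1 hs.2⟩
    have h2 : ∀ i j, w (ε.symm ((u i j).1 + (u i j).2)) = rowColEquiv Nᗮ N (u i j) :=
      fun i j => by rw [← hw, w.apply_symm_apply]
    simpa only [LinearEquiv.coe_coe, h2] using h1
  · obtain ⟨u, rfl⟩ : ∃ u : Fin n → Fin n → Nᗮ × N, t = fun i j => rowColEquiv Nᗮ N (u i j) :=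
      ⟨fun i j => (rowColEquiv Nᗮ N).symm (t i j), by simp⟩
    have h1 := (matBound_rowColEquiv_iff (x := fun i j => (u i j).1)
      (y := fun i j => (u i j).2)).1 ht
    have hb := (hbd n (fun i j => (u i j).1) (fun i j => (u i j).2)).2.2 h1.1 h1.2
    rw [matBound_iff_rowPart_colPart fun i j => hS (Subtype.property _)]
    simpa only [LinearEquiv.coe_coe, hw, hα, hβ] using hb

/-- A completely complemented subspace of `R ⊕ C` is completely isomorphic to `H_r ⊕ K_c`. -/
theorem exists_equiv_rowSpace_colSpace (hS : S ≤ directSum R C) (hcl : IsClosed (S : Set (𝓗 →L[ℂ] 𝓗)))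
    (hproj : ∀ x : S, P (Submodule.inclusion hS x) = x) (hP : IsCB P) :
    ∃ (H K : Type)
      (_ : NormedAddCommGroup H) (_ : InnerProductSpace ℂ H) (_ : CompleteSpace H)
      (_ : NormedAddCommGroup K) (_ : InnerProductSpace ℂ K) (_ : CompleteSpace K)
      (w : S ≃ₗ[ℂ] directSum (rowSpace H) (colSpace K)),
      cbNorm (w : S →ₗ[ℂ] directSum (rowSpace H) (colSpace K)) ≤ ENNReal.ofReal 2 ∧
      cbNorm (w.symm : directSum (rowSpace H) (colSpace K) →ₗ[ℂ] S) ≤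
        ENNReal.ofReal (1 + 3 * (cbNorm P).toReal) := by
  obtain ⟨V, _, _, _, ε, α, β, hin, hα, hβ⟩ := exists_hilbert_parametrization rowPart colPart
    hcl.isComplete fun s hs => norm_sq_le_rowPart_colPart (hS hs)
  choose x y hxy hxr hxc hyr hyc using exists_add_rowPart_colPart
  let ι : V → directSum R C := fun v => Submodule.inclusion hS (ε.symm v)
  have hαι : ∀ v, rowPart (ι v : 𝓗 →L[ℂ] 𝓗) = α v := hα
  have hβι : ∀ v, colPart (ι v : 𝓗 →L[ℂ] 𝓗) = β v := hβ
  have hαε : ∀ s, α (ε s) = rowPart (s : 𝓗 →L[ℂ] 𝓗) := fun s => by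
    rw [← hα, ε.symm_apply_apply]
  have hβε : ∀ s, β (ε s) = colPart (s : 𝓗 →L[ℂ] 𝓗) := fun s => by
    rw [← hβ, ε.symm_apply_apply]
  obtain ⟨N, hN, hbd⟩ := exists_row_col_splitting α β hin
    (p := fun v => ε (P (x (ι v)))) (q := fun v => ε (P (y (ι v))))
    (M := (cbNorm P).toReal) ENNReal.toReal_nonneg
    (fun v => by rw [← map_add, ← map_add, hxy, hproj, ε.apply_symm_apply])
    (fun n v hv => by
      simp only [hβε]
      refine hP.sum_sq_colPart_le hS (fun i => hxc _) fun η => ?_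
      simpa only [hxr, hαι] using hv η)
    (fun n v hv => by
      simp only [hαε]
      refine hP.sum_sq_rowPart_le hS (fun i => hyr _) fun η => ?_
      simpa only [hyc, hβι] using hv η)
  have : CompleteSpace N := hN.completeSpace_coe
  obtain ⟨w, hw, hw'⟩ := exists_cbNorm_le_of_splitting hS ε hα hβ hN ENNReal.toReal_nonneg hbd
  exact ⟨Nᗮ, N, inferInstance, inferInstance, inferInstance, inferInstance, inferInstance,
    inferInstance, w, hw, hw'⟩

/-- P fixes a unit vector of S, viewed as a 1 × 1 matrix. This lets the additive constant in 1 + 3M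
be absorbed. -/
theorem one_le_cbNorm_of_projection (hS : S ≤ directSum R C)
    (hproj : ∀ x : S, P (Submodule.inclusion hS x) = x) (hP : IsCB P) {s : S} (hs : s ≠ 0) :
    1 ≤ (cbNorm P).toReal := by
  have hs0 : 0 < ‖(s : 𝓗 →L[ℂ] 𝓗)‖ :=
    (norm_nonneg _).lt_of_ne' fun h => hs (Subtype.ext (norm_eq_zero.1 h))
  set t : S := ((‖(s : 𝓗 →L[ℂ] 𝓗)‖ : ℂ)⁻¹) • s with ht
  have htn : ‖(t : 𝓗 →L[ℂ] 𝓗)‖ = 1 := by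
    rw [ht, Submodule.coe_smul, norm_smul, norm_inv, Complex.norm_real, norm_norm,
      inv_mul_cancel₀ hs0.ne']
  have h1 := hP.matBound (n := 1) (x := fun _ _ => Submodule.inclusion hS t) fun h => by
    have := (t : 𝓗 →L[ℂ] 𝓗).le_opNorm (h 0)
    rw [htn, one_mul] at this
    simpa using pow_le_pow_left₀ (norm_nonneg _) this 2
  rw [← htn]
  refine ContinuousLinearMap.opNorm_le_bound _ ENNReal.toReal_nonneg fun h => ?_
  have h2 := h1 fun _ => h
  simp only [hproj] at h2
  refine (abs_le_of_sq_le_sq' ?_ (by positivity)).2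
  simpa [mul_pow] using h2

end Complemented

theorem cbNorm_eq_zero_of_subsingleton {H₁ K₁ H₂ K₂ : Type*}
    [NormedAddCommGroup H₁] [InnerProductSpace ℂ H₁] [NormedAddCommGroup K₁]
    [InnerProductSpace ℂ K₁] [NormedAddCommGroup H₂] [InnerProductSpace ℂ H₂]
    [NormedAddCommGroup K₂] [InnerProductSpace ℂ K₂] {E : Submodule ℂ (H₁ →L[ℂ] K₁)}
    {F : Submodule ℂ (H₂ →L[ℂ] K₂)} [Subsingleton E] (u : E →ₗ[ℂ] F) : cbNorm u = 0 := by
  refine nonpos_iff_eq_zero.1 ((cbNorm_le le_rfl fun n x _ h => ?_).trans_eq ENNReal.ofReal_zero)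
  have : ∀ i j, u (x i j) = 0 := fun i j => by rw [Subsingleton.elim (x i j) 0, map_zero]
  simp [this]

end OpSp

end

theorem theorem5 :
    ∃ c : NNReal,
      ∀ (S : Submodule ℂ
          (WithLp 2 (OpSp.EllTwo × OpSp.EllTwo) →L[ℂ] WithLp 2 (OpSp.EllTwo × OpSp.EllTwo)))
        (hS : S ≤ OpSp.directSum OpSp.R OpSp.C), IsClosed (S : Set
          (WithLp 2 (OpSp.EllTwo × OpSp.EllTwo) →L[ℂ] WithLp 2 (OpSp.EllTwo × OpSp.EllTwo))) →
      ∀ P : OpSp.directSum OpSp.R OpSp.C →ₗ[ℂ] S,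
        (∀ x : S, P (Submodule.inclusion hS x) = x) → OpSp.IsCB P →
      ∃ (H K : Type)
        (_ : NormedAddCommGroup H) (_ : InnerProductSpace ℂ H) (_ : CompleteSpace H)
        (_ : NormedAddCommGroup K) (_ : InnerProductSpace ℂ K) (_ : CompleteSpace K),
        OpSp.CompletelyIsomorphic S (OpSp.directSum (OpSp.rowSpace H) (OpSp.colSpace K)) ∧
        OpSp.cbDist S (OpSp.directSum (OpSp.rowSpace H) (OpSp.colSpace K)) ≤
          (c : ENNReal) * OpSp.cbNorm P := by
  -- The value 8 comes from 2(1 + 3M) ≤ 8M, valid for M = ‖P‖_cb ≥ 1.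
  refine ⟨8, fun S hS hcl P hproj hP => ?_⟩
  obtain ⟨H, K, i₁, i₂, i₃, i₄, i₅, i₆, w, hw, hw'⟩ :=
    OpSp.exists_equiv_rowSpace_colSpace hS hcl hproj hP
  have hcb := hw.trans_lt ENNReal.ofReal_lt_top
  have hcb' := hw'.trans_lt ENNReal.ofReal_lt_top
  refine ⟨H, K, i₁, i₂, i₃, i₄, i₅, i₆, ⟨w, hcb, hcb'⟩,
    (iInf_le_of_le w (iInf_le_of_le hcb (iInf_le _ hcb'))).trans ?_⟩
  -- If S = 0 then ‖P‖_cb = 0 and the bound M ≥ 1 fails, but ‖w‖_cb vanishes as well.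
  rcases subsingleton_or_nontrivial S with hsub | hnt
  · rw [OpSp.cbNorm_eq_zero_of_subsingleton, zero_mul]
    exact zero_le
  · obtain ⟨s, hs⟩ := exists_ne (0 : S)
    have hM := OpSp.one_le_cbNorm_of_projection hS hproj hP hs
    calc _ ≤ ENNReal.ofReal 2 * ENNReal.ofReal (1 + 3 * (OpSp.cbNorm P).toReal) :=
          mul_le_mul' hw hw'
      _ ≤ ENNReal.ofReal (8 * (OpSp.cbNorm P).toReal) := by
          rw [← ENNReal.ofReal_mul zero_le_two]
          exact ENNReal.ofReal_le_ofReal (by linarith)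
      _ = _ := by
          rw [ENNReal.ofReal_mul (by norm_num), ENNReal.ofReal_toReal hP.ne]
          simp
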